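/- Let $d,k\ge 0$ be integers, and let $S^d\subseteq\mathbb R^{d+1}$ be the unit sphere. A weighted point is a pair $\mathbf a=(a,r_a)\in S^d\times[0,\infty)$ with location $a$; it is identified with the point $r_a a\in\mathbb R^{d+1}$. Let $\mathcal A$ be a finite set of weighted points that is - generic: no $d+1$ of them are linearly dependent, and no $d+2$ of them are affinely dependent, as points of $\mathbb R^{d+1}$; - $k$-balanced: every $d$-dimensional plane of $\mathbb R^{d+1}$ through the origin has at least $k+1$ points of $\mathcal A$ strictly on each of its two sides. Any $d+1$ weighted points of $\mathcal A$ define the spherical $d$-simplex that consists of the points of $S^d$ that are nonnegative linear combinations of their locations. The heft of this simplex is the number of points of $\mathcal A$ that are strictly separated from the origin by the $d$-plane through the $d+1$ weighted points. The simplex is incident to $\mathbf a$ if $\mathbf a$ is one of the $d+1$ weighted points. Call $x\in S^d$ generic if it does not lie on a common $(d-1)$-dimensional great-sphere (the intersection of $S^d$ with a $d$-dimensional linear subspace) with the locations of $d$ weighted points of $\mathcal A$. Then: 1. Every generic $x\in S^d$ lies in exactly $\binom{d+k}{d}$ spherical $d$-simplices of heft $k$. 2. For every $\mathbf a\in\mathcal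 A$ there is a neighborhood $U$ of its location $a$ in $S^d$ such that every generic $y\in U$ lies in at most $\binom{d+k}{d}$ spherical $d$-simplices of heft at most $k$ that are incident to $\mathbf a$. -/

import Mathlib

open scoped NNReal RealInnerProductSpace Topology

namespace WeightedSphere

/-- The unit sphere `S^d` in `ℝ^(d+1)`. -/
abbrev Sph (d : ℕ) : Type := Metric.sphere (0 : EuclideanSpace ℝ (Fin (d + 1))) 1

/-- A weighted point: a location `a ∈ S^d` together with a radius `r ∈ [0, ∞)`
(the weight is `r ^ 2 - 1`). -/
abbrev WPoint (d : ℕ) : Type := Sph d × ℝ≥0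

/-- The location of a weighted point, as a unit vector of `ℝ^(d+1)`. -/
def loc {d : ℕ} (p : WPoint d) : EuclideanSpace ℝ (Fin (d + 1)) :=
  (p.1 : EuclideanSpace ℝ (Fin (d + 1)))

/-- The point `r a` of `ℝ^(d+1)` whose polar coordinates are the weighted point `(a, r)`. -/
def pos {d : ℕ} (p : WPoint d) : EuclideanSpace ℝ (Fin (d + 1)) :=
  (p.2 : ℝ) • loc p

/-- A finite set of weighted points is generic if no `d + 1` of its points (as points of
`ℝ^(d+1)`) are linearly dependent, that is, lie on a common `d`-plane through the origin, and no
`d + 2` of them are affinely dependent, that is, lie on a common `d`-plane. -/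
def IsGeneric {d : ℕ} (A : Finset (WPoint d)) : Prop :=
  (∀ T ⊆ A, T.card = d + 1 → LinearIndependent ℝ (fun p : T => pos p.1)) ∧
    (∀ T ⊆ A, T.card = d + 2 → AffineIndependent ℝ (fun p : T => pos p.1))

open Classical in
/-- A finite set of weighted points is `k`-balanced if there are at least `k + 1` of its points on
each (open) side of every `d`-plane through the origin. The sides of the plane with normal `v` are
obtained from `v` and `-v`. -/
def IsBalanced {d : ℕ} (k : ℕ) (A : Finset (WPoint d)) : Prop :=
  ∀ v : EuclideanSpace ℝ (Fin (d + 1)), v ≠ 0 →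
    k + 1 ≤ (A.filter (fun p => 0 < ⟪v, pos p⟫)).card

/-- The `d`-plane through the weighted points in `T` (for `d + 1` affinely independent points). -/
noncomputable def plane {d : ℕ} (T : Finset (WPoint d)) : AffineSubspace ℝ (EuclideanSpace ℝ (Fin (d + 1))) :=
  affineSpan ℝ (pos '' (T : Set (WPoint d)))

open Classical in
/-- The heft of the simplex with vertex set `T`: the number of weighted points of `A` that the
`d`-plane through `T` (strictly) separates from the origin. The vertices themselves lie on the
plane, so they are not counted. -/
noncomputable def heft {d : ℕ} (A T : Finset (WPoint d)) : ℕ :=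
  (A.filter (fun p => (plane T).SOppSide 0 (pos p))).card

/-- The spherical simplex spanned by the locations of the weighted points in `T`: all points of
the sphere that are nonnegative combinations of these locations. -/
def sphericalSimplex {d : ℕ} (T : Finset (WPoint d)) : Set (Sph d) :=
  {x | (x : EuclideanSpace ℝ (Fin (d + 1))) ∈
    PointedCone.hull ℝ (loc '' (T : Set (WPoint d)))}

/-- The point `x` of the sphere does not lie on a common `(d - 1)`-dimensional great-sphere with
`d` locations. -/
def AvoidsGreatSpheres {d : ℕ} (A : Finset (WPoint d)) (x : Sph d) : Prop :=
  ∀ T ⊆ A, T.card = d →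
    (x : EuclideanSpace ℝ (Fin (d + 1))) ∉ Submodule.span ℝ (loc '' (T : Set (WPoint d)))

open Classical in
/-- The (vertex sets of the) `d`-simplices of `A` with heft exactly `k` that contain `x`. -/
noncomputable def heftyAt {d : ℕ} (k : ℕ) (A : Finset (WPoint d)) (x : Sph d) :
    Finset (Finset (WPoint d)) :=
  (A.powersetCard (d + 1)).filter (fun T => heft A T = k ∧ x ∈ sphericalSimplex T)

open Classical in
/-- The (vertex sets of the) `d`-simplices of `A` with heft at most `k` that are incident to the
weighted point `a` and contain `x`. -/
noncomputable def incidentAt {d : ℕ} (k : ℕ) (A : Finset (WPoint d)) (a : WPoint d) (x : Sph d) :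
    Finset (Finset (WPoint d)) :=
  (A.powersetCard (d + 1)).filter
    (fun T => heft A T ≤ k ∧ a ∈ T ∧ x ∈ sphericalSimplex T)

end WeightedSphere

namespace WeightedSphere

/-! ### Triangular families of homogeneous polynomials -/

/-! Each simplex `T` is encoded by the vector `dualPoint T`, whose inner product is 1 on the plane
of `T`; the heft counts the points with inner product above 1. The key comparison is
`IsGeneric.eq_of_inner_le`: if distinct `T`, `T'` contain the same generic point and the plane of
`T'` has the smaller or equal dual value there, then some vertex of `T'` lies strictly beyond the
plane of `T`.

Exact count: delete a set `J` of `j ≤ k` points. By balance the rest still positively spans, so the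
ray through `x` leaves its convex hull through exactly one simplex, namely the only one disjoint
from `J` with all points beyond it in `J` (`IsGeneric.existsUnique_simplex`). Counting pairs `(J,
T)` for every `j ≤ k` gives a unitriangular linear system for the numbers of simplices of each heft,
and Vandermonde's convolution identifies its solution.

Incident bound: to each `T` attach a form of degree `k` that vanishes at a dual point when some
point beyond `T` lies on the corresponding plane. By the key comparison these forms are triangular
against the dual points, hence independent, and their number is at most the dimension of the space
of forms. -/

theorem finrank_homogeneousSubmodule_le {n k : ℕ} :
    Module.finrank ℝ (MvPolynomial.homogeneousSubmodule (Fin n) ℝ k) ≤ (n + k - 1).choose k := by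
  classical
  let M : Finset (MvPolynomial (Fin n) ℝ) :=
    (Finset.univ.finsuppAntidiag k).image fun e => MvPolynomial.monomial e (1 : ℝ)
  have hspan : MvPolynomial.homogeneousSubmodule (Fin n) ℝ k ≤
      Submodule.span ℝ (M : Set (MvPolynomial (Fin n) ℝ)) := by
    intro f hf
    rw [f.as_sum]
    refine Submodule.sum_mem _ fun e he => ?_
    rw [← mul_one (f.coeff e), ← smul_eq_mul, ← MvPolynomial.smul_monomial]
    refine Submodule.smul_mem _ _ (Submodule.subset_span ?_)
    have hdeg := MvPolynomial.IsHomogeneous.degree_eq_sum_deg_support hf he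
    refine Finset.mem_coe.2 (Finset.mem_image_of_mem _ ?_)
    rw [Finset.mem_finsuppAntidiag]
    refine ⟨?_, Finset.subset_univ _⟩
    rw [hdeg]
    exact (Finset.sum_subset (Finset.subset_univ _) (by simp)).symm
  calc Module.finrank ℝ (MvPolynomial.homogeneousSubmodule (Fin n) ℝ k)
      ≤ Module.finrank ℝ (Submodule.span ℝ (M : Set (MvPolynomial (Fin n) ℝ))) :=
        Submodule.finrank_mono hspan
    _ ≤ M.card := finrank_span_finset_le_card M
    _ ≤ (Finset.univ.finsuppAntidiag k).card := Finset.card_image_le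
    _ = (n + k - 1).choose k := by
        rw [Finset.card_finsuppAntidiag_nat_eq_choose, Finset.card_univ, Fintype.card_fin]

/-- If homogeneous polynomials `f i` of degree `k` and points `v i` are triangular with respect to
a real-valued order `φ`, then there are at most as many indices as monomials of degree `k`. -/
theorem card_le_of_triangular {n k : ℕ} {ι : Type*} (B : Finset ι) (φ : ι → ℝ)
    (f : ι → MvPolynomial (Fin n) ℝ) (v : ι → Fin n → ℝ)
    (hf : ∀ i ∈ B, (f i).IsHomogeneous k)
    (hdiag : ∀ i ∈ B, MvPolynomial.eval (v i) (f i) ≠ 0)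
    (htri : ∀ i ∈ B, ∀ j ∈ B, i ≠ j → φ j ≤ φ i → MvPolynomial.eval (v j) (f i) = 0) :
    B.card ≤ (n + k - 1).choose k := by
  classical
  have hli : LinearIndependent ℝ (fun i : B => f i) := by
    rw [Fintype.linearIndependent_iff]
    intro c hc
    by_contra! hne
    obtain ⟨i₀, hi₀⟩ := hne
    -- Evaluating the relation at the point of a `φ`-minimal index with nonzero coefficient kills
    -- every other term, ties included.
    obtain ⟨i, hi, hmin⟩ := Finset.exists_min_image (Finset.univ.filter fun i : B => c i ≠ 0)
      (fun i => φ i) ⟨i₀, by simpa using hi₀⟩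
    have hev := congrArg (MvPolynomial.eval (v i)) hc
    rw [map_sum, Finset.sum_eq_single i] at hev
    · simp only [MvPolynomial.smul_eval, map_zero, mul_eq_zero] at hev
      exact hev.elim (Finset.mem_filter.1 hi).2 (hdiag i i.2)
    · intro j _ hji
      rw [MvPolynomial.smul_eval]
      by_cases hcj : c j = 0
      · simp [hcj]
      · rw [htri j j.2 i i.2 (fun h => hji (Subtype.ext h)) (hmin j (by simpa using hcj)), mul_zero]
    · simp
  have hmem : ∀ i : B, f i ∈ MvPolynomial.homogeneousSubmodule (Fin n) ℝ k := fun i => hf i i.2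
  have hli' : LinearIndependent ℝ
      (fun i : B => (⟨f i, hmem i⟩ : MvPolynomial.homogeneousSubmodule (Fin n) ℝ k)) :=
    LinearIndependent.of_comp (Submodule.subtype _) hli
  have : Module.Finite ℝ (MvPolynomial.homogeneousSubmodule (Fin n) ℝ k) :=
    Module.Finite.iff_fg.2 (MvPolynomial.homogeneousSubmodule_fg (Fin n) ℝ k)
  simpa using hli'.fintype_card_le_finrank.trans finrank_homogeneousSubmodule_le

/-! ### A triangular system of counting identities -/

/-- The Vandermonde convolution for the coefficients of negative powers of `1 - X`. -/
theorem sum_antidiagonal_add_choose_mul_add_choose (a b j : ℕ) :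
    ∑ q ∈ Finset.HasAntidiagonal.antidiagonal j, (a + q.1).choose a * (b + q.2).choose b =
      (a + b + 1 + j).choose j := by
  have h := congrArg Units.val (PowerSeries.invOneSubPow_add (S := ℤ) (a + 1) (b + 1))
  rw [Units.val_mul, show a + 1 + (b + 1) = a + b + 1 + 1 by ring] at h
  simp only [PowerSeries.invOneSubPow_val_succ_eq_mk_add_choose] at h
  have h' := congrArg (PowerSeries.coeff j) h
  rw [PowerSeries.coeff_mul] at h'
  simp only [PowerSeries.coeff_mk] at h'
  rw [Nat.choose_symm_add] at h'
  exact_mod_cast h'.symm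

/-- Vandermonde with `b = m - (d + 1) - j`: the expected counts solve the system. -/
theorem sum_range_add_choose_mul_choose {d m j : ℕ} (hm : d + 1 + j ≤ m) :
    ∑ i ∈ Finset.range (j + 1), (d + i).choose d * (m - (d + 1) - i).choose (j - i) =
      m.choose j := by
  obtain ⟨b, rfl⟩ := Nat.exists_eq_add_of_le hm
  rw [show d + 1 + j + b = d + b + 1 + j by ring, ← sum_antidiagonal_add_choose_mul_add_choose,
    Finset.Nat.sum_antidiagonal_eq_sum_range_succ_mk]
  refine Finset.sum_congr rfl fun i hi => ?_
  have hij := Finset.mem_range_succ_iff.1 hi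
  congr 1
  rw [show d + b + 1 + j - (d + 1) - i = b + (j - i) by omega, ← Nat.choose_symm_add]

/-- The system of Clarkson's counting identities determines its unknowns. -/
theorem eq_choose_of_sum_eq_choose {d m k : ℕ} (hm : d + 1 + k ≤ m) (g : ℕ → ℕ)
    (hg : ∀ j ≤ k, ∑ i ∈ Finset.range (j + 1), g i * (m - (d + 1) - i).choose (j - i) =
      m.choose j) :
    ∀ j ≤ k, g j = (d + j).choose d := by
  intro j
  induction j using Nat.strong_induction_on with
  | _ j ih =>
    intro hj
    have h1 := hg j hj
    have h2 := sum_range_add_choose_mul_choose (d := d) (m := m) (j := j) (by omega)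
    -- The newest unknown has coefficient 1, so no division is needed.
    rw [Finset.sum_range_succ, Nat.sub_self, Nat.choose_zero_right, mul_one] at h1 h2
    rw [Finset.sum_congr rfl fun i hi => by
      rw [ih i (Finset.mem_range.1 hi) ((Finset.mem_range.1 hi).le.trans hj)]] at h1
    omega

/-! ### Supporting planes -/

variable {d : ℕ}

/-- The vector `v` for which the plane through the points of `T` is `{w | ⟪v, w⟫ = 1}`. -/
noncomputable def dualPoint (T : Finset (WPoint d)) : EuclideanSpace ℝ (Fin (d + 1)) :=
  Classical.epsilon fun v => ∀ p ∈ T, ⟪v, pos p⟫ = 1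

theorem radius_pos {T : Finset (WPoint d)} (hli : LinearIndependent ℝ (fun p : T => pos p.1))
    {p : WPoint d} (hp : p ∈ T) : 0 < (p.2 : ℝ) := by
  refine lt_of_le_of_ne p.2.2 fun h => hli.ne_zero ⟨p, hp⟩ ?_
  change (p.2 : ℝ) • loc p = 0
  rw [← h, zero_smul]

theorem exists_nonneg_of_mem_sphericalSimplex {T : Finset (WPoint d)}
    (hli : LinearIndependent ℝ (fun p : T => pos p.1)) {x : Sph d} (hx : x ∈ sphericalSimplex T) :
    ∃ c : WPoint d → ℝ, (∀ p, 0 ≤ c p) ∧ (x : EuclideanSpace ℝ (Fin (d + 1))) =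
      ∑ p ∈ T, c p • pos p := by
  obtain ⟨c, hc⟩ := Submodule.mem_span_image_finset_iff_exists_fun' _ |>.1 hx
  refine ⟨fun p => c p / p.2, fun p => div_nonneg (c p).2 p.2.2, ?_⟩
  rw [← hc]
  refine Finset.sum_congr rfl fun p hp => ?_
  rw [pos, smul_smul, div_mul_cancel₀ _ (radius_pos hli hp).ne']
  rfl

section Basis

variable {T : Finset (WPoint d)} (hT : T.card = d + 1)
  (hli : LinearIndependent ℝ (fun p : T => pos p.1))

include hT hli

theorem span_pos_eq_top : Submodule.span ℝ (pos '' (T : Set (WPoint d))) = ⊤ := by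
  have h := hli.span_eq_top_of_card_eq_finrank' (by simp [hT])
  rw [Set.image_eq_range]
  exact h

theorem exists_sum_smul_pos_eq (w : EuclideanSpace ℝ (Fin (d + 1))) :
    ∃ c : WPoint d → ℝ, ∑ p ∈ T, c p • pos p = w := by
  rw [← Submodule.mem_span_image_finset_iff_exists_fun', span_pos_eq_top hT hli]
  trivial

/-- The vertices form a basis, so a functional equal to 1 on all of them exists; Riesz
representation turns it into a vector. -/
theorem inner_dualPoint {p : WPoint d} (hp : p ∈ T) : ⟪dualPoint T, pos p⟫ = 1 := by
  suffices h : ∃ v, ∀ p ∈ T, ⟪v, pos p⟫ = 1 from Classical.epsilon_spec h p hp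
  let b := Module.Basis.mk hli (by
    rw [hli.span_eq_top_of_card_eq_finrank' (by simp [hT])])
  let f : EuclideanSpace ℝ (Fin (d + 1)) →L[ℝ] ℝ :=
    LinearMap.toContinuousLinearMap (b.constr ℝ fun _ => (1 : ℝ))
  refine ⟨(InnerProductSpace.toDual ℝ _).symm f, fun p hp => ?_⟩
  rw [InnerProductSpace.toDual_symm_apply]
  have h := b.constr_basis ℝ (fun _ => (1 : ℝ)) ⟨p, hp⟩
  rwa [Module.Basis.coe_mk] at h

theorem eq_dualPoint {v : EuclideanSpace ℝ (Fin (d + 1))} (hv : ∀ p ∈ T, ⟪v, pos p⟫ = 1) :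
    v = dualPoint T := by
  refine ext_inner_right ℝ fun w => ?_
  obtain ⟨c, rfl⟩ := exists_sum_smul_pos_eq hT hli w
  simp only [inner_sum, inner_smul_right]
  exact Finset.sum_congr rfl fun p hp => by rw [hv p hp, inner_dualPoint hT hli hp]

theorem mem_plane_iff {w : EuclideanSpace ℝ (Fin (d + 1))} :
    w ∈ plane T ↔ ⟪dualPoint T, w⟫ = 1 := by
  constructor
  · intro hw
    refine affineSpan_induction (p := fun w => ⟪dualPoint T, w⟫ = 1) hw ?_ ?_
    · rintro _ ⟨p, hp, rfl⟩
      exact inner_dualPoint hT hli hp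
    · intro c u v w hu hv hw
      simp [inner_add_right, inner_smul_right, inner_sub_right, hu, hv, hw]
  · intro hw
    obtain ⟨c, rfl⟩ := exists_sum_smul_pos_eq hT hli w
    have hc : ∑ p ∈ T, c p = 1 := by
      rw [← hw, inner_sum]
      exact Finset.sum_congr rfl fun p hp => by
        rw [inner_smul_right, inner_dualPoint hT hli hp, mul_one]
    have hc' : ∑ p : T, c p = 1 := by rw [Finset.sum_coe_sort T c, hc]
    have h := affineCombination_mem_affineSpan hc' (fun p : T => pos p.1)
    rw [Finset.affineCombination_eq_linear_combination _ _ _ hc',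
      Finset.sum_coe_sort T fun p => c p • pos p] at h
    rw [plane, Set.image_eq_range]
    exact h

theorem sOppSide_plane_iff {w : EuclideanSpace ℝ (Fin (d + 1))} :
    (plane T).SOppSide 0 w ↔ 1 < ⟪dualPoint T, w⟫ := by
  have h0 : (0 : EuclideanSpace ℝ (Fin (d + 1))) ∉ plane T := by simp [mem_plane_iff hT hli]
  constructor
  · intro h
    obtain ⟨u, hu, ⟨⟨t, ⟨ht0, ht1⟩, rfl⟩, -, hne⟩⟩ := h.exists_sbtw
    rw [mem_plane_iff hT hli] at hu
    simp only [AffineMap.lineMap_apply, vsub_eq_sub, sub_zero, vadd_eq_add, add_zero,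
      inner_smul_right] at hu hne
    have ht : t ≠ 1 := fun h => hne (by rw [h, one_smul])
    have : t < 1 := lt_of_le_of_ne ht1 ht
    nlinarith
  · intro h
    have hpos : 0 < ⟪dualPoint T, w⟫ := one_pos.trans h
    have hw : w ≠ 0 := fun h => by simp [h] at hpos
    have hu : ⟪dualPoint T, w⟫⁻¹ • w ∈ plane T := by
      rw [mem_plane_iff hT hli, inner_smul_right, inv_mul_cancel₀ hpos.ne']
    refine Sbtw.sOppSide_of_notMem_of_mem (y := ⟪dualPoint T, w⟫⁻¹ • w) ⟨⟨⟪dualPoint T, w⟫⁻¹,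
      ⟨by positivity, inv_le_one_of_one_le₀ h.le⟩, by simp [AffineMap.lineMap_apply]⟩, ?_, ?_⟩ h0 hu
    · simp [hpos.ne', hw]
    · intro he
      rw [he, mem_plane_iff hT hli] at hu
      exact h.ne' hu

open Classical in
theorem heft_eq_card (A : Finset (WPoint d)) :
    heft A T = (A.filter fun p => 1 < ⟪dualPoint T, pos p⟫).card := by
  simp only [heft, sOppSide_plane_iff hT hli]

/-- A generic point of a simplex is a positive combination of its vertices. -/
theorem exists_pos_of_mem_sphericalSimplex {A : Finset (WPoint d)} (hTA : T ⊆ A) {x : Sph d}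
    (hgx : AvoidsGreatSpheres A x) (hx : x ∈ sphericalSimplex T) :
    ∃ c : WPoint d → ℝ, (∀ p ∈ T, 0 < c p) ∧ (x : EuclideanSpace ℝ (Fin (d + 1))) =
      ∑ p ∈ T, c p • pos p := by
  classical
  obtain ⟨c, hc0, hc⟩ := exists_nonneg_of_mem_sphericalSimplex hli hx
  refine ⟨c, fun p hp => lt_of_le_of_ne (hc0 p) fun h => ?_, hc⟩
  -- A vanishing coefficient would put `x` in the span of the other `d` locations.
  refine hgx (T.erase p) ((T.erase_subset p).trans hTA) (by simp [hp, hT]) ?_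
  rw [hc, ← Finset.add_sum_erase T _ hp, ← h, zero_smul, zero_add]
  exact Submodule.sum_mem _ fun q hq => Submodule.smul_mem _ _ <| Submodule.smul_mem _ _ <|
    Submodule.subset_span ⟨q, hq, rfl⟩

end Basis

/-! ### Genericity -/

/-- Differences of the points span the space and are orthogonal to `v`, forcing `v = 0`. -/
theorem not_forall_inner_eq_one {T : Finset (WPoint d)} (hT : T.card = d + 2)
    (hai : AffineIndependent ℝ (fun p : T => pos p.1)) (v : EuclideanSpace ℝ (Fin (d + 1))) :
    ¬ ∀ p ∈ T, ⟪v, pos p⟫ = 1 := by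
  intro hv
  have htop := hai.vectorSpan_eq_top_of_card_eq_finrank_add_one (by simp [hT])
  have hmem : v ∈ vectorSpan ℝ (Set.range fun p : T => pos p.1) := htop ▸ Submodule.mem_top
  have hzero : ⟪v, v⟫ = 0 := by
    refine Submodule.span_induction (p := fun w _ => ⟪v, w⟫ = 0) ?_ (inner_zero_right _) ?_ ?_ hmem
    · rintro _ ⟨_, ⟨p, rfl⟩, _, ⟨q, rfl⟩, rfl⟩
      simp [inner_sub_right, hv p p.2, hv q q.2]
    · intro u w _ _ hu hw
      rw [inner_add_right, hu, hw, add_zero]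
    · intro c w _ hw
      rw [inner_smul_right, hw, mul_zero]
  obtain ⟨p, hp⟩ := Finset.card_pos.1 (by omega : 0 < T.card)
  have := hv p hp
  rw [inner_self_eq_zero.1 hzero, inner_zero_left] at this
  exact zero_ne_one this

theorem IsGeneric.card_le_of_inner_eq_one {A : Finset (WPoint d)} (hgen : IsGeneric A)
    {S : Finset (WPoint d)} (hS : S ⊆ A) {v : EuclideanSpace ℝ (Fin (d + 1))}
    (hv : ∀ p ∈ S, ⟪v, pos p⟫ = 1) : S.card ≤ d + 1 := by
  by_contra! h
  obtain ⟨T, hTS, hT⟩ := Finset.exists_subset_card_eq (show d + 2 ≤ S.card from h)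
  exact not_forall_inner_eq_one hT (hgen.2 T (hTS.trans hS) hT) v fun p hp => hv p (hTS hp)

theorem IsGeneric.mem_of_inner_dualPoint_eq_one {A : Finset (WPoint d)} (hgen : IsGeneric A)
    {T : Finset (WPoint d)} (hTA : T ⊆ A) (hT : T.card = d + 1) {p : WPoint d} (hp : p ∈ A)
    (h : ⟪dualPoint T, pos p⟫ = 1) : p ∈ T := by
  classical
  by_contra hpT
  have := hgen.card_le_of_inner_eq_one (S := insert p T) (v := dualPoint T)
    (Finset.insert_subset hp hTA) fun q hq => ?_
  · rw [Finset.card_insert_of_notMem hpT] at this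
    omega
  · rcases Finset.mem_insert.1 hq with rfl | hq
    · exact h
    · exact inner_dualPoint hT (hgen.1 T hTA hT) hq

/-- Two simplices containing a common generic point coincide if no vertex of the second one is
separated from the origin by the plane of the first one, and the first plane is at least as low
in the direction of the point. -/
theorem IsGeneric.eq_of_inner_le {A : Finset (WPoint d)} (hgen : IsGeneric A)
    {T T' : Finset (WPoint d)} (hTA : T ⊆ A) (hT : T.card = d + 1) (hTA' : T' ⊆ A)
    (hT' : T'.card = d + 1) {x : Sph d} (hgx : AvoidsGreatSpheres A x)
    (hx : x ∈ sphericalSimplex T')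
    (hle : ⟪dualPoint T', (x : EuclideanSpace ℝ (Fin (d + 1)))⟫ ≤
      ⟪dualPoint T, (x : EuclideanSpace ℝ (Fin (d + 1)))⟫)
    (hfeas : ∀ p ∈ T', ⟪dualPoint T, pos p⟫ ≤ 1) : T = T' := by
  have hli' := hgen.1 T' hTA' hT'
  obtain ⟨c, hc0, hc⟩ := exists_pos_of_mem_sphericalSimplex hT' hli' hTA' hgx hx
  -- The sum is the difference of the two dual values at `x`. Its terms are nonnegative, so all
  -- vanish and every vertex of `T'` lies on the plane of `T`.
  have hsum : ∑ p ∈ T', c p * (1 - ⟪dualPoint T, pos p⟫) ≤ 0 := by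
    rw [hc] at hle
    simp only [inner_sum, inner_smul_right, mul_sub, Finset.sum_sub_distrib, mul_one] at hle ⊢
    rw [Finset.sum_congr rfl fun p hp => by rw [inner_dualPoint hT' hli' hp, mul_one]] at hle
    linarith
  have hnonneg : ∀ p ∈ T', 0 ≤ c p * (1 - ⟪dualPoint T, pos p⟫) := fun p hp =>
    mul_nonneg (hc0 p hp).le (sub_nonneg.2 (hfeas p hp))
  have hzero := (Finset.sum_eq_zero_iff_of_nonneg hnonneg).1
    (le_antisymm hsum (Finset.sum_nonneg hnonneg))
  refine (Finset.eq_of_subset_of_card_le (fun p hp => ?_) (by rw [hT, hT'])).symm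
  refine hgen.mem_of_inner_dualPoint_eq_one hTA hT (hTA' hp) ?_
  have := (mul_eq_zero.1 (hzero p hp)).resolve_left (hc0 p hp).ne'
  linarith

/-! ### Simplices of bounded heft incident to a point -/

/-- The linear form `⟪·, u⟫` as a polynomial. -/
noncomputable def linearForm (u : EuclideanSpace ℝ (Fin (d + 1))) :
    MvPolynomial (Fin (d + 1)) ℝ :=
  ∑ i, MvPolynomial.C (u i) * MvPolynomial.X i

theorem isHomogeneous_linearForm (u : EuclideanSpace ℝ (Fin (d + 1))) :
    (linearForm u).IsHomogeneous 1 :=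
  MvPolynomial.IsHomogeneous.sum _ _ _ fun i _ => MvPolynomial.isHomogeneous_C_mul_X (u i) i

theorem eval_linearForm (u v : EuclideanSpace ℝ (Fin (d + 1))) :
    MvPolynomial.eval (v : Fin (d + 1) → ℝ) (linearForm u) = ⟪v, u⟫ := by
  simp [linearForm, PiLp.inner_apply]

theorem card_incidentAt_le {A : Finset (WPoint d)} (hgen : IsGeneric A) (k : ℕ) {a : WPoint d}
    {y : Sph d} (hy : AvoidsGreatSpheres A y) :
    (incidentAt k A a y).card ≤ (d + k).choose d := by
  classical
  have hmem : ∀ T ∈ incidentAt k A a y,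
      T ⊆ A ∧ T.card = d + 1 ∧ heft A T ≤ k ∧ a ∈ T ∧ y ∈ sphericalSimplex T := fun T hT => by
    simpa [incidentAt, and_assoc] using hT
  let V : Finset (WPoint d) → Finset (WPoint d) := fun T =>
    A.filter fun p => 1 < ⟪dualPoint T, pos p⟫
  -- All dual points considered satisfy `⟪v, pos a⟫ = 1`. Hence the power of the form of `a` pads
  -- the degree to `k` without changing values, and `pos p - pos a` homogenizes `⟪v, pos p⟫ - 1`.
  let f : Finset (WPoint d) → MvPolynomial (Fin (d + 1)) ℝ := fun T =>
    linearForm (pos a) ^ (k - (V T).card) * ∏ p ∈ V T, linearForm (pos p - pos a)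
  have heval : ∀ T ∈ incidentAt k A a y, ∀ T' : Finset (WPoint d),
      T' ∈ incidentAt k A a y →
      MvPolynomial.eval (dualPoint T' : Fin (d + 1) → ℝ) (f T) =
        ∏ p ∈ V T, (⟪dualPoint T', pos p⟫ - 1) := fun T hT T' hT' => by
    obtain ⟨hTA', hcard', -, ha', -⟩ := hmem T' hT'
    have ha := inner_dualPoint hcard' (hgen.1 T' hTA' hcard') ha'
    simp only [f, map_mul, map_pow, map_prod, eval_linearForm, inner_sub_right, ha, one_pow,
      one_mul]
  have h := card_le_of_triangular (k := k) (incidentAt k A a y)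
    (fun T => ⟪dualPoint T, (y : EuclideanSpace ℝ (Fin (d + 1)))⟫) f
    (fun T => (dualPoint T : Fin (d + 1) → ℝ)) ?_ ?_ ?_
  · rwa [show d + 1 + k - 1 = d + k by omega, ← Nat.choose_symm_add] at h
  · intro T hT
    obtain ⟨hTA, hcard, hheft, -, -⟩ := hmem T hT
    rw [heft_eq_card hcard (hgen.1 T hTA hcard)] at hheft
    have h1 := (isHomogeneous_linearForm (pos a)).pow (k - (V T).card)
    have h2 := MvPolynomial.IsHomogeneous.prod (V T) (fun p => linearForm (pos p - pos a))
      (fun _ => 1) fun p _ => isHomogeneous_linearForm _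
    have h3 := h1.mul h2
    rwa [one_mul, Finset.sum_const, smul_eq_mul, mul_one, Nat.sub_add_cancel hheft] at h3
  · intro T hT
    rw [heval T hT T hT]
    exact Finset.prod_ne_zero_iff.2 fun p hp => (sub_pos.2 (Finset.mem_filter.1 hp).2).ne'
  · intro T hT T' hT' hne hle
    obtain ⟨hTA, hcard, -, -, -⟩ := hmem T hT
    obtain ⟨hTA', hcard', -, -, hy'⟩ := hmem T' hT'
    rw [heval T hT T' hT', Finset.prod_eq_zero_iff]
    by_contra! hcon
    refine hne (hgen.eq_of_inner_le hTA hcard hTA' hcard' hy hy' hle fun p hp => ?_)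
    by_contra! hlt
    exact hcon p (Finset.mem_filter.2 ⟨hTA' hp, hlt⟩)
      (sub_eq_zero.2 (inner_dualPoint hcard' (hgen.1 T' hTA' hcard') hp))

/-! ### Simplices of heft `k` containing a generic point -/

theorem IsBalanced.exists_inner_pos {k : ℕ} {A : Finset (WPoint d)} (hbal : IsBalanced k A)
    {J : Finset (WPoint d)} (hJ : J.card ≤ k) {v : EuclideanSpace ℝ (Fin (d + 1))} (hv : v ≠ 0) :
    ∃ p ∈ A, p ∉ J ∧ 0 < ⟪v, pos p⟫ := by
  classical
  obtain ⟨p, hp, hpJ⟩ := Finset.exists_mem_notMem_of_card_lt_card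
    (Nat.lt_of_lt_of_le (Nat.lt_succ_of_le hJ) (hbal v hv))
  obtain ⟨hpA, hpos⟩ := Finset.mem_filter.1 hp
  exact ⟨p, hpA, hpJ, hpos⟩

/-- Fewer vectors would not span, and a nonzero `v` orthogonal to all of them would violate `hR`. -/
theorem succ_le_card_of_exists_inner_pos {R : Finset (WPoint d)}
    (hR : ∀ v : EuclideanSpace ℝ (Fin (d + 1)), v ≠ 0 → ∃ p ∈ R, 0 < ⟪v, pos p⟫) :
    d + 1 ≤ R.card := by
  classical
  by_contra! h
  have hlt : Submodule.span ℝ ((R.image pos : Finset _) : Set (EuclideanSpace ℝ (Fin (d + 1)))) ≠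
      ⊤ := fun htop => by
    have h1 := finrank_span_finset_le_card (R := ℝ) (R.image pos)
    rw [Set.finrank, htop, finrank_top, finrank_euclideanSpace_fin] at h1
    exact absurd (h1.trans Finset.card_image_le) h.not_ge
  obtain ⟨v, hv, hv0⟩ := Submodule.exists_mem_ne_zero_of_ne_bot
    (mt Submodule.orthogonal_eq_bot_iff.1 hlt)
  obtain ⟨p, hp, hpos⟩ := hR v hv0
  have h0 := Submodule.inner_left_of_mem_orthogonal (Submodule.subset_span
    (Finset.mem_coe.2 (Finset.mem_image_of_mem pos hp))) hv
  exact hpos.ne' h0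

/-- The polar dual of a finite set that positively spans the space is compact. -/
theorem isCompact_polar {R : Finset (WPoint d)}
    (hR : ∀ v : EuclideanSpace ℝ (Fin (d + 1)), v ≠ 0 → ∃ p ∈ R, 0 < ⟪v, pos p⟫) :
    IsCompact {v : EuclideanSpace ℝ (Fin (d + 1)) | ∀ p ∈ R, ⟪v, pos p⟫ ≤ 1} := by
  have hne : R.Nonempty := Finset.card_pos.1
    (Nat.lt_of_lt_of_le (Nat.succ_pos d) (succ_le_card_of_exists_inner_pos hR))
  have hclosed : IsClosed {v : EuclideanSpace ℝ (Fin (d + 1)) | ∀ p ∈ R, ⟪v, pos p⟫ ≤ 1} := by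
    simp only [Set.ofPred_forall]
    exact isClosed_biInter fun p _ => isClosed_le (by fun_prop) continuous_const
  -- The minimum of `g` on the unit sphere is positive, and its inverse bounds the norm on the
  -- polar.
  let g : EuclideanSpace ℝ (Fin (d + 1)) → ℝ := fun v => R.sup' hne fun p => ⟪v, pos p⟫
  have hg : Continuous g := Continuous.finset_sup'_apply hne fun p _ => by fun_prop
  obtain ⟨u, hu, hmin⟩ := (isCompact_sphere (0 : EuclideanSpace ℝ (Fin (d + 1))) 1).exists_isMinOn
    (NormedSpace.sphere_nonempty.2 zero_le_one) hg.continuousOn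
  have hgu : 0 < g u := by
    obtain ⟨p, hp, hpos⟩ := hR u (ne_zero_of_mem_unit_sphere ⟨u, hu⟩)
    exact hpos.trans_le (Finset.le_sup' (fun p => ⟪u, pos p⟫) hp)
  refine Metric.isCompact_of_isClosed_isBounded hclosed
    ((Metric.isBounded_closedBall (x := 0) (r := (g u)⁻¹)).subset fun v hv => ?_)
  rw [mem_closedBall_zero_iff]
  rcases eq_or_ne v 0 with rfl | hv0
  · simpa using hgu.le
  have hvn : 0 < ‖v‖ := norm_pos_iff.2 hv0
  have hle : g u ≤ g (‖v‖⁻¹ • v) :=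
    hmin (by simp [norm_smul, hvn.ne'] : ‖v‖⁻¹ • v ∈ Metric.sphere (0 : EuclideanSpace ℝ _) 1)
  have hle' : g (‖v‖⁻¹ • v) ≤ ‖v‖⁻¹ := Finset.sup'_le hne _ fun p hp => by
    rw [real_inner_smul_left]
    exact mul_le_of_le_one_right (inv_nonneg.2 hvn.le) (hv p hp)
  exact (le_inv_comm₀ hgu hvn).1 (hle.trans hle')

/-- The ray through a point leaves the convex hull of a positively spanning set through a face
with a supporting plane. -/
theorem exists_mem_hull_active {R : Finset (WPoint d)}
    (hR : ∀ v : EuclideanSpace ℝ (Fin (d + 1)), v ≠ 0 → ∃ p ∈ R, 0 < ⟪v, pos p⟫)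
    {x : EuclideanSpace ℝ (Fin (d + 1))} (hx : x ≠ 0) :
    ∃ v : EuclideanSpace ℝ (Fin (d + 1)), (∀ p ∈ R, ⟪v, pos p⟫ ≤ 1) ∧
      x ∈ PointedCone.hull ℝ (loc '' {p | p ∈ R ∧ ⟪v, pos p⟫ = 1}) := by
  classical
  -- Linear programming duality: the optimal `v` over the polar gives the supporting plane, and `x /
  -- ⟪v, x⟫` is where the ray exits.
  obtain ⟨v, hv, hmax⟩ := (isCompact_polar hR).exists_isMaxOn (f := fun v => ⟪v, x⟫)
    ⟨0, fun p _ => by simp⟩ (by fun_prop)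
  rw [isMaxOn_iff] at hmax
  have hscale : ∀ w : EuclideanSpace ℝ (Fin (d + 1)), ∀ c : ℝ, 0 < c →
      (∀ p ∈ R, ⟪w, pos p⟫ ≤ c) → ⟪w, x⟫ ≤ c * ⟪v, x⟫ := fun w c hc hw => by
    have h := hmax (c⁻¹ • w) fun p hp => by
      rw [real_inner_smul_left, inv_mul_le_one₀ hc]
      exact hw p hp
    rwa [real_inner_smul_left, inv_mul_le_iff₀ hc] at h
  have hM : 0 < ⟪v, x⟫ := by
    obtain ⟨p, hp, hpos⟩ := hR x hx
    have h := hscale x (R.sup' ⟨p, hp⟩ fun q => ⟪x, pos q⟫)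
      (hpos.trans_le (Finset.le_sup' (fun q => ⟪x, pos q⟫) hp))
      fun q hq => Finset.le_sup' (fun q => ⟪x, pos q⟫) hq
    exact pos_of_mul_pos_right ((real_inner_self_pos.2 hx).trans_le h)
      (hpos.trans_le (Finset.le_sup' (fun q => ⟪x, pos q⟫) hp)).le
  -- A separating functional, rescaled into the polar, would beat the maximum.
  have hmem : ⟪v, x⟫⁻¹ • x ∈ convexHull ℝ ((R.image pos : Finset _) : Set (EuclideanSpace ℝ _)) := by
    by_contra hcon
    obtain ⟨φ, c, hφ, hφx⟩ := geometric_hahn_banach_closed_point (convex_convexHull ℝ _)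
      ((R.image pos).finite_toSet.isClosed_convexHull ℝ) hcon
    let w := (InnerProductSpace.toDual ℝ (EuclideanSpace ℝ (Fin (d + 1)))).symm φ
    have hw : ∀ u, ⟪w, u⟫ = φ u := fun u => InnerProductSpace.toDual_symm_apply
    have hwR : ∀ p ∈ R, ⟪w, pos p⟫ < c := fun p hp => by
      rw [hw]
      exact hφ _ (subset_convexHull ℝ _ (Finset.mem_coe.2 (Finset.mem_image_of_mem pos hp)))
    have hc : 0 < c := by
      rcases eq_or_ne w 0 with h0 | h0
      · obtain ⟨p, hp, -⟩ := hR x hx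
        simpa [h0] using hwR p hp
      · obtain ⟨p, hp, hpos⟩ := hR w h0
        exact hpos.trans (hwR p hp)
    have h1 := hscale w c hc fun p hp => (hwR p hp).le
    rw [← hw, real_inner_smul_right, lt_inv_mul_iff₀ hM] at hφx
    linarith
  refine ⟨v, hv, ?_⟩
  obtain ⟨c, hc0, hc1, hcx⟩ := Finset.mem_convexHull'.1 hmem
  -- Complementary slackness: only points on the supporting plane carry weight.
  have hsum : ∑ y ∈ R.image pos, c y * (1 - ⟪v, y⟫) = 0 := by
    have h := congrArg (fun u => ⟪v, u⟫) hcx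
    simp only [inner_sum, real_inner_smul_right, inv_mul_cancel₀ hM.ne'] at h
    simp only [mul_sub, mul_one, Finset.sum_sub_distrib, hc1, h, sub_self]
  have hzero := (Finset.sum_eq_zero_iff_of_nonneg fun y hy => by
    obtain ⟨p, hp, rfl⟩ := Finset.mem_image.1 hy
    exact mul_nonneg (hc0 _ hy) (sub_nonneg.2 (hv p hp))).1 hsum
  have hxeq : x = ∑ y ∈ R.image pos, (⟪v, x⟫ * c y) • y := by
    simp only [mul_smul, ← Finset.smul_sum, hcx]
    rw [smul_smul, mul_inv_cancel₀ hM.ne', one_smul]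
  rw [hxeq]
  refine Submodule.sum_mem _ fun y hy => ?_
  obtain ⟨p, hp, rfl⟩ := Finset.mem_image.1 hy
  rcases mul_eq_zero.1 (hzero _ hy) with h | h
  · rw [h, mul_zero, zero_smul]
    exact Submodule.zero_mem _
  · rw [pos, smul_smul]
    exact Submodule.smul_mem _ (⟨_, mul_nonneg (mul_nonneg hM.le (hc0 _ hy)) p.2.2⟩ : ℝ≥0)
      (Submodule.subset_span ⟨p, ⟨hp, by linarith⟩, rfl⟩)

/-- The active points number at most `d + 1` by affine genericity, and no fewer because `x` avoids
spans of `d` locations. -/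
theorem IsGeneric.exists_simplex {A : Finset (WPoint d)} (hgen : IsGeneric A)
    {R : Finset (WPoint d)} (hRA : R ⊆ A)
    (hR : ∀ v : EuclideanSpace ℝ (Fin (d + 1)), v ≠ 0 → ∃ p ∈ R, 0 < ⟪v, pos p⟫)
    {x : Sph d} (hx : AvoidsGreatSpheres A x) :
    ∃ T ⊆ R, T.card = d + 1 ∧ x ∈ sphericalSimplex T ∧ ∀ p ∈ R, ⟪dualPoint T, pos p⟫ ≤ 1 := by
  classical
  obtain ⟨v, hv, hmem⟩ := exists_mem_hull_active hR (ne_zero_of_mem_unit_sphere x)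
  let T : Finset (WPoint d) := R.filter fun p => ⟪v, pos p⟫ = 1
  have hTv : ∀ p ∈ T, ⟪v, pos p⟫ = 1 := fun p hp => (Finset.mem_filter.1 hp).2
  have hTR : T ⊆ R := Finset.filter_subset _ _
  have hxT : x ∈ sphericalSimplex T := by
    have hset : (T : Set (WPoint d)) = {p | p ∈ R ∧ ⟪v, pos p⟫ = 1} := Finset.coe_filter _ _
    change _ ∈ PointedCone.hull ℝ _
    rwa [hset]
  have hle := hgen.card_le_of_inner_eq_one (hTR.trans hRA) hTv
  have hcard : T.card = d + 1 := by
    refine le_antisymm hle ?_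
    by_contra! hlt
    -- Genericity of `x` concerns exactly `d` locations, so a smaller active set is padded.
    obtain ⟨S, hTS, hSA, hS⟩ := Finset.exists_subsuperset_card_eq (hTR.trans hRA)
      (Nat.lt_succ_iff.1 hlt) ((Nat.le_succ d).trans
        ((succ_le_card_of_exists_inner_pos hR).trans (Finset.card_le_card hRA)))
    exact hx S hSA hS (Submodule.span_mono (Set.image_mono (Finset.coe_subset.2 hTS))
      (PointedCone.hull_le_span (R := ℝ) _ hxT))
  refine ⟨T, hTR, hcard, hxT, fun p hp => ?_⟩
  rw [← eq_dualPoint hcard (hgen.1 T (hTR.trans hRA) hcard) hTv]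
  exact hv p hp

/-- The number of `j`-element subsets of `A` that contain `V` and avoid `T`. -/
theorem card_filter_subset_disjoint {α : Type*} [DecidableEq α] {A T V : Finset α} (hT : T ⊆ A)
    (hV : V ⊆ A) (hTV : Disjoint T V) {j : ℕ} (hj : V.card ≤ j) :
    ((A.powersetCard j).filter fun J => V ⊆ J ∧ Disjoint T J).card =
      (A.card - T.card - V.card).choose (j - V.card) := by
  have hA : (A \ (T ∪ V)).card = A.card - T.card - V.card := by
    rw [Finset.card_sdiff_of_subset (Finset.union_subset hT hV),
      Finset.card_union_of_disjoint hTV, Nat.sub_sub]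
  rw [← hA, ← Finset.card_powersetCard]
  refine Finset.card_nbij' (· \ V) (· ∪ V) ?_ ?_ ?_ ?_
  · intro J hJ
    simp only [Finset.coe_filter, Finset.mem_powersetCard, Set.mem_ofPred_eq] at hJ
    obtain ⟨⟨hJA, hJj⟩, hVJ, hTJ⟩ := hJ
    refine Finset.mem_coe.2 (Finset.mem_powersetCard.2 ⟨fun p hp => ?_, ?_⟩)
    · have := Finset.disjoint_right.1 hTJ
      grind
    · rw [Finset.card_sdiff_of_subset hVJ, hJj]
  · intro K hK
    obtain ⟨hKA, hKj⟩ := Finset.mem_powersetCard.1 (Finset.mem_coe.1 hK)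
    have hKTV := (Finset.subset_sdiff.1 hKA).2
    rw [Finset.disjoint_union_right] at hKTV
    simp only [Finset.coe_filter, Finset.mem_powersetCard, Set.mem_ofPred_eq]
    refine ⟨⟨Finset.union_subset (hKA.trans Finset.sdiff_subset) hV, ?_⟩,
      Finset.subset_union_right, Finset.disjoint_union_right.2 ⟨hKTV.1.symm, hTV⟩⟩
    rw [Finset.card_union_of_disjoint hKTV.2, hKj, Nat.sub_add_cancel hj]
  · intro J hJ
    simp only [Finset.coe_filter, Set.mem_ofPred_eq] at hJ
    exact Finset.sdiff_union_of_subset hJ.2.1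
  · intro K hK
    obtain ⟨hKA, -⟩ := Finset.mem_powersetCard.1 (Finset.mem_coe.1 hK)
    have hKTV := (Finset.subset_sdiff.1 hKA).2
    rw [Finset.disjoint_union_right] at hKTV
    exact Finset.union_sdiff_cancel_right hKTV.2

/-- Double counting of the pairs `(J, T)` with `V T ⊆ J` and `J` disjoint from `T`, when every
`j`-element set `J` occurs in exactly one such pair. -/
theorem sum_card_filter_mul_choose {α : Type*} [DecidableEq α] {A : Finset α}
    {B : Finset (Finset α)} {V : Finset α → Finset α} {n j : ℕ}
    (hB : ∀ T ∈ B, T ⊆ A ∧ T.card = n) (hV : ∀ T ∈ B, V T ⊆ A ∧ Disjoint T (V T))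
    (hone : ∀ J ⊆ A, J.card = j → ∃! T, T ∈ B ∧ V T ⊆ J ∧ Disjoint T J) :
    ∑ i ∈ Finset.range (j + 1),
      (B.filter fun T => (V T).card = i).card * (A.card - n - i).choose (j - i) =
        A.card.choose j := by
  have hdouble := Finset.sum_card_bipartiteAbove_eq_sum_card_bipartiteBelow
    (s := A.powersetCard j) (t := B) fun J T => V T ⊆ J ∧ Disjoint T J
  have hleft : ∀ J ∈ A.powersetCard j,
      (B.bipartiteAbove (fun J T => V T ⊆ J ∧ Disjoint T J) J).card = 1 := by
    intro J hJ
    obtain ⟨hJA, hJj⟩ := Finset.mem_powersetCard.1 hJ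
    obtain ⟨T, hT, huniq⟩ := hone J hJA hJj
    refine Finset.card_eq_one.2 ⟨T, Finset.eq_singleton_iff_unique_mem.2 ⟨?_, fun T' hT' => ?_⟩⟩
    · exact Finset.mem_filter.2 hT
    · exact huniq T' (Finset.mem_filter.1 hT')
  -- The case split matters: for `(V T).card > j` truncated subtraction would make the binomial 1,
  -- not 0.
  have hright : ∀ T ∈ B,
      ((A.powersetCard j).bipartiteBelow (fun J T => V T ⊆ J ∧ Disjoint T J) T).card =
        if (V T).card ≤ j then (A.card - n - (V T).card).choose (j - (V T).card) else 0 := by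
    intro T hT
    split_ifs with h
    · rw [← (hB T hT).2]
      exact card_filter_subset_disjoint (hB T hT).1 (hV T hT).1 (hV T hT).2 h
    · refine Finset.card_eq_zero.2 (Finset.filter_eq_empty_iff.2 fun J hJ hVJ => h ?_)
      rw [← (Finset.mem_powersetCard.1 hJ).2]
      exact Finset.card_le_card hVJ.1
  rw [Finset.sum_congr rfl hleft, Finset.sum_congr rfl hright, Finset.sum_const, smul_eq_mul,
    mul_one, Finset.card_powersetCard, ← Finset.sum_filter] at hdouble
  rw [hdouble, ← Finset.sum_fiberwise_of_maps_to (t := Finset.range (j + 1))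
    (g := fun T => (V T).card)
    (fun T hT => Finset.mem_range_succ_iff.2 (Finset.mem_filter.1 hT).2)]
  refine Finset.sum_congr rfl fun i hi => ?_
  have hij := Finset.mem_range_succ_iff.1 hi
  rw [← smul_eq_mul, ← Finset.sum_const, Finset.filter_filter]
  refine Finset.sum_congr (Finset.filter_congr fun T _ => ?_) fun T hT => ?_
  · exact ⟨fun h => ⟨h.trans_le hij, h⟩, And.right⟩
  · rw [(Finset.mem_filter.1 hT).2.2]

/-- The simplex containing `x` whose heft becomes `0` after removing `J` exists and is unique. -/
theorem IsGeneric.existsUnique_simplex {k : ℕ} {A : Finset (WPoint d)} (hgen : IsGeneric A)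
    (hbal : IsBalanced k A) {x : Sph d} (hx : AvoidsGreatSpheres A x) {J : Finset (WPoint d)}
    (hJ : J.card ≤ k) :
    ∃! T, (T ⊆ A ∧ T.card = d + 1 ∧ x ∈ sphericalSimplex T) ∧
      (∀ p ∈ A, 1 < ⟪dualPoint T, pos p⟫ → p ∈ J) ∧ Disjoint T J := by
  classical
  have hR : ∀ v : EuclideanSpace ℝ (Fin (d + 1)), v ≠ 0 → ∃ p ∈ A \ J, 0 < ⟪v, pos p⟫ :=
    fun v hv => by
      obtain ⟨p, hpA, hpJ, hpos⟩ := hbal.exists_inner_pos hJ hv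
      exact ⟨p, Finset.mem_sdiff.2 ⟨hpA, hpJ⟩, hpos⟩
  have hfeas : ∀ T T' : Finset (WPoint d), (∀ p ∈ A, 1 < ⟪dualPoint T, pos p⟫ → p ∈ J) →
      T' ⊆ A → Disjoint T' J → ∀ p ∈ T', ⟪dualPoint T, pos p⟫ ≤ 1 :=
    fun T T' hT hTA' hT' p hp => by
      by_contra! hlt
      exact Finset.disjoint_left.1 hT' hp (hT p (hTA' hp) hlt)
  obtain ⟨T, hTR, hcard, hxT, hTle⟩ := hgen.exists_simplex Finset.sdiff_subset hR hx
  obtain ⟨hTA, hTJ⟩ := Finset.subset_sdiff.1 hTR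
  have hVT : ∀ p ∈ A, 1 < ⟪dualPoint T, pos p⟫ → p ∈ J := fun p hpA hlt => by
    by_contra hpJ
    exact (hTle p (Finset.mem_sdiff.2 ⟨hpA, hpJ⟩)).not_gt hlt
  refine ⟨T, ⟨⟨hTA, hcard, hxT⟩, hVT, hTJ⟩, ?_⟩
  rintro T' ⟨⟨hTA', hcard', hxT'⟩, hVT', hTJ'⟩
  -- Neither simplex has a vertex beyond the other's plane, so the comparison lemma applies in
  -- whichever order the dual values come.
  rcases le_total ⟪dualPoint T, (x : EuclideanSpace ℝ (Fin (d + 1)))⟫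
    ⟪dualPoint T', (x : EuclideanSpace ℝ (Fin (d + 1)))⟫ with h | h
  · exact hgen.eq_of_inner_le hTA' hcard' hTA hcard hx hxT h (hfeas T' T hVT' hTA hTJ)
  · exact (hgen.eq_of_inner_le hTA hcard hTA' hcard' hx hxT' h (hfeas T T' hVT hTA' hTJ')).symm

theorem sum_card_heftyAt_mul_choose {k : ℕ} {A : Finset (WPoint d)} (hgen : IsGeneric A)
    (hbal : IsBalanced k A) {x : Sph d} (hx : AvoidsGreatSpheres A x) {j : ℕ} (hj : j ≤ k) :
    ∑ i ∈ Finset.range (j + 1),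
      (heftyAt i A x).card * (A.card - (d + 1) - i).choose (j - i) = A.card.choose j := by
  classical
  let B := (A.powersetCard (d + 1)).filter fun T => x ∈ sphericalSimplex T
  let V : Finset (WPoint d) → Finset (WPoint d) := fun T =>
    A.filter fun p => 1 < ⟪dualPoint T, pos p⟫
  have hB : ∀ T, T ∈ B ↔ T ⊆ A ∧ T.card = d + 1 ∧ x ∈ sphericalSimplex T := fun T => by
    rw [Finset.mem_filter, Finset.mem_powersetCard, and_assoc]
  have hV : ∀ T J, V T ⊆ J ↔ ∀ p ∈ A, 1 < ⟪dualPoint T, pos p⟫ → p ∈ J := fun T J =>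
    ⟨fun h p hp hlt => h (Finset.mem_filter.2 ⟨hp, hlt⟩),
      fun h p hp => h p (Finset.mem_filter.1 hp).1 (Finset.mem_filter.1 hp).2⟩
  have hhefty : ∀ i, heftyAt i A x = B.filter fun T => (V T).card = i := fun i => by
    ext T
    rw [Finset.mem_filter, hB, heftyAt, Finset.mem_filter, Finset.mem_powersetCard]
    constructor
    · rintro ⟨⟨hTA, hcard⟩, hh, hxT⟩
      exact ⟨⟨hTA, hcard, hxT⟩, (heft_eq_card hcard (hgen.1 T hTA hcard) A).symm.trans hh⟩
    · rintro ⟨⟨hTA, hcard, hxT⟩, hh⟩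
      exact ⟨⟨hTA, hcard⟩, (heft_eq_card hcard (hgen.1 T hTA hcard) A).trans hh, hxT⟩
  simp only [hhefty]
  refine sum_card_filter_mul_choose (fun T hT => ?_) (fun T hT => ?_) fun J _ hJj => ?_
  · obtain ⟨hTA, hcard, -⟩ := (hB T).1 hT
    exact ⟨hTA, hcard⟩
  · obtain ⟨hTA, hcard, -⟩ := (hB T).1 hT
    exact ⟨Finset.filter_subset _ _, Finset.disjoint_left.2 fun p hp hpV =>
      (Finset.mem_filter.1 hpV).2.ne' (inner_dualPoint hcard (hgen.1 T hTA hcard) hp)⟩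
  · simp only [hB, hV]
    exact hgen.existsUnique_simplex hbal hx (hJj.trans_le hj)

/-- After deleting any `k` points the rest still positively spans. The bound keeps the subtractions
in the counting system exact. -/
theorem IsBalanced.add_le_card {k : ℕ} {A : Finset (WPoint d)} (hbal : IsBalanced k A) :
    d + 1 + k ≤ A.card := by
  classical
  obtain ⟨v, hv⟩ := exists_ne (0 : EuclideanSpace ℝ (Fin (d + 1)))
  have hk : k ≤ A.card :=
    (Nat.le_succ k).trans ((hbal v hv).trans (Finset.card_le_card (Finset.filter_subset _ _)))
  obtain ⟨J, hJA, hJ⟩ := Finset.exists_subset_card_eq hk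
  have h := succ_le_card_of_exists_inner_pos (R := A \ J) fun v hv => by
    obtain ⟨p, hpA, hpJ, hpos⟩ := hbal.exists_inner_pos hJ.le hv
    exact ⟨p, Finset.mem_sdiff.2 ⟨hpA, hpJ⟩, hpos⟩
  rw [Finset.card_sdiff_of_subset hJA, hJ] at h
  omega

theorem card_heftyAt {k : ℕ} {A : Finset (WPoint d)} (hgen : IsGeneric A)
    (hbal : IsBalanced k A) {x : Sph d} (hx : AvoidsGreatSpheres A x) :
    (heftyAt k A x).card = (d + k).choose d :=
  eq_choose_of_sum_eq_choose hbal.add_le_card (fun i => (heftyAt i A x).card)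
    (fun _ hj => sum_card_heftyAt_mul_choose hgen hbal hx hj) k le_rfl

end WeightedSphere

theorem theorem3p4 (d k : ℕ) (A : Finset (WeightedSphere.WPoint d))
    (hgen : WeightedSphere.IsGeneric A) (hbal : WeightedSphere.IsBalanced k A) :
    (∀ x : WeightedSphere.Sph d, WeightedSphere.AvoidsGreatSpheres A x →
      (WeightedSphere.heftyAt k A x).card = (d + k).choose d) ∧
    (∀ a ∈ A, ∀ᶠ y : WeightedSphere.Sph d in 𝓝 a.1,
      WeightedSphere.AvoidsGreatSpheres A y →
        (WeightedSphere.incidentAt k A a y).card ≤ (d + k).choose d) :=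
  ⟨fun _ hx => WeightedSphere.card_heftyAt hgen hbal hx,
    -- The bound holds at every generic point, so the whole sphere serves as neighborhood.
    fun _ _ => Filter.Eventually.of_forall fun _ hy =>
      WeightedSphere.card_incidentAt_le hgen k hy⟩
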